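/- Let $a$ and $b$ be positive integers. In the $(a:b)$ Maker--Breaker game with finite board $X$ and family of winning sets $\mathcal F\subseteq 2^X$, Breaker and Maker alternately move, Breaker moving first; in each move Maker claims $a$, respectively Breaker claims $b$, previously unclaimed elements of $X$ (all remaining ones, if fewer are left). Maker wins at the moment she has claimed all elements of some $F\in\mathcal F$. Let $\tau_{\mathcal F}(a:b)$, the shortest duration of the game, be the least number $t$ such that Maker has a strategy that, against every play of Breaker, wins within $t$ moves of Maker; $\tau_{\mathcal F}(a:b)=\infty$ if there is no such $t$. In the perfect matching game on the complete graph $K_n$, the board is $E(K_n)$ and the family $\mathcal{PM}_n$ of winning sets consists of all sets of $\lfloor n/2\rfloor$ pairwise disjoint edges of $K_n$. **Theorem.** Let $a\ge 1$ be an integer. Then there is an $N=N(a)$ such that for every $n\ge N$, $$ \tau_{\mathcal{PM}_n}(a:a)= \begin{cases} \frac{n}{2a}+1, & \text{if } a=1 \text{ and } n \text{ is even},\\ \left\lceil \frac{n}{2a}\right\rceil-1, & \text{if } 2a\mid n-1,\\ \left\lceil \frac{n}{2a}\right\rceil, & \text{otherwise.} \end{cases} $$ -/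

import Mathlib

namespace PositionalGame

/-- A position of a Maker-Breaker game: the elements claimed so far by each player. -/
structure Position (X : Type*) where
  /-- the elements claimed by Maker -/
  maker : Finset X
  /-- the elements claimed by Breaker -/
  breaker : Finset X

/-- The elements of the board that no player has claimed. -/
def Position.free {X : Type*} [DecidableEq X] (board : Finset X) (p : Position X) : Finset X :=
  board \ (p.maker ∪ p.breaker)

/-- A legal move of a player with bias `q` when the unclaimed elements are `free`: exactly `q` of
them are claimed, or all of them if fewer than `q` are left. -/
def IsMove {X : Type*} (q : ℕ) (free S : Finset X) : Prop :=
  S ⊆ free ∧ S.card = min q free.card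

/-- A strategy of Maker: her reply to the list of all moves that Breaker has made so far
(the most recent move first; the list is nonempty, as Breaker starts the game). -/
abbrev MakerStrategy (X : Type*) := List (Finset X) → Finset X

/-- The position after the rounds in which Breaker made the moves in the list
(the most recent move first) and Maker replied according to the strategy `σ`. -/
def position {X : Type*} [DecidableEq X] (σ : MakerStrategy X) : List (Finset X) → Position X
  | [] => ⟨∅, ∅⟩
  | S :: h => ⟨(position σ h).maker ∪ σ (S :: h), (position σ h).breaker ∪ S⟩

/-- The position in the middle of a round: Breaker has claimed `S`, Maker has not replied yet. -/
def Position.afterBreaker {X : Type*} [DecidableEq X] (p : Position X) (S : Finset X) :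
    Position X :=
  ⟨p.maker, p.breaker ∪ S⟩

/-- All moves of Breaker (with bias `b`) in the list are legal, against Maker's strategy `σ`. -/
def BreakerLegal {X : Type*} [DecidableEq X] (board : Finset X) (b : ℕ) (σ : MakerStrategy X) :
    List (Finset X) → Prop
  | [] => True
  | S :: h => BreakerLegal board b σ h ∧ IsMove b ((position σ h).free board) S

/-- Maker's strategy `σ` answers every legal play of Breaker with a legal move. -/
def MakerLegal {X : Type*} [DecidableEq X] (board : Finset X) (a b : ℕ) (σ : MakerStrategy X) :
    Prop :=
  ∀ (h : List (Finset X)) (S : Finset X), BreakerLegal board b σ (S :: h) →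
    IsMove a (((position σ h).afterBreaker S).free board) (σ (S :: h))

/-- In the `(a : b)` Maker-Breaker game with winning sets `F`, Breaker going first, Maker has a
strategy to win within `t` moves: however Breaker plays, after `t` rounds Maker has claimed all
elements of some winning set. (A player facing a fully claimed board makes empty moves, and
claiming further elements cannot destroy a win, so no termination rule is needed.) -/
def MakerWinsWithin {X : Type*} [DecidableEq X] (board : Finset X) (F : Set (Finset X))
    (a b t : ℕ) : Prop :=
  ∃ σ : MakerStrategy X, MakerLegal board a b σ ∧
    ∀ h : List (Finset X), h.length = t → BreakerLegal board b σ h →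
      ∃ W ∈ F, W ⊆ (position σ h).maker

/-- The shortest duration of the `(a : b)` Maker-Breaker game: the least `t` such that
Maker has a strategy to win within `t` moves, and `⊤` if there is no such `t`. -/
noncomputable def shortestDuration {X : Type*} [DecidableEq X] (board : Finset X)
    (F : Set (Finset X)) (a b : ℕ) : ℕ∞ :=
  ⨅ (t : ℕ) (_ : MakerWinsWithin board F a b t), (t : ℕ∞)

/-- The edge set of the complete graph on `n` vertices. -/
def completeEdges (n : ℕ) : Finset (Sym2 (Fin n)) :=
  (⊤ : SimpleGraph (Fin n)).edgeFinset

/-- The winning sets of the perfect matching game on the complete graph on `n` vertices: all sets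
of `⌊n / 2⌋` pairwise disjoint edges. -/
def perfectMatchings (n : ℕ) : Set (Finset (Sym2 (Fin n))) :=
  {W | W ⊆ completeEdges n ∧
    (∀ e ∈ W, ∀ f ∈ W, e ≠ f → ∀ v : Fin n, ¬ (v ∈ e ∧ v ∈ f)) ∧ W.card = n / 2}

end PositionalGame

/-! Write $m=\lfloor n/2\rfloor$. Maker needs $m$ edges and gets $a$ per move, so $\lceil m/a\rceil$
is a lower bound. It is attained unless $a=1$ and $n$ is even. In that case a win in $m$ moves
wastes no edge, so before the last round a unique edge is missing, and Breaker takes it.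

For the upper bounds Maker keeps the uncovered vertices free of Breaker edges (`IsClear`). Breaker
then adds at most $a$ edges there, and `exists_matching_clearing` answers with $a$ disjoint edges
that remove them all from the uncovered part. For $a=1$ and $n$ odd this runs to the end.

For $a\ge 2$ at most $a$ pairs remain for the last move. They are matched directly when they are
many compared with Breaker's edges. Otherwise an edge $uv$ of the large existing matching is
exchanged for $xu$ and $vy$, which costs two edges per pair (`exists_extension`).

For $a=1$ and $n$ even, Maker stops clearing at four uncovered vertices and spends one extra edge on
a double threat (`IsClear.canWin_three`). -/

namespace PositionalGame

open Finset

/-! ### From positions that can be won to strategies. -/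

section Strategy

variable {X : Type*}

theorem exists_isMove (q : ℕ) (free : Finset X) : ∃ S, IsMove q free S := by
  obtain ⟨S, hS, hc⟩ := exists_subset_card_eq (min_le_right q free.card)
  exact ⟨S, hS, hc⟩

variable [DecidableEq X]

/-- Maker, having claimed `M` while Breaker has claimed `B`, can complete a winning set within `k`
further rounds, each player claiming at most as many elements as the bias allows. -/
def CanWin (board : Finset X) (F : Set (Finset X)) (a b : ℕ) : ℕ → Finset X → Finset X → Prop
  | 0, M, _ => ∃ W ∈ F, W ⊆ M
  | k + 1, M, B => ∀ S ⊆ board, S.card ≤ b → ∃ T ⊆ board, T.card ≤ a ∧ Disjoint T (B ∪ S) ∧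
      CanWin board F a b k (M ∪ T) (B ∪ S)

variable {board : Finset X} {F : Set (Finset X)} {a b : ℕ}

theorem CanWin.mono {k : ℕ} {M M' B : Finset X} (h : CanWin board F a b k M B) (hM : M ⊆ M') :
    CanWin board F a b k M' B := by
  induction k generalizing M M' B with
  | zero =>
    obtain ⟨W, hW, hWM⟩ := h
    exact ⟨W, hW, hWM.trans hM⟩
  | succ k ih =>
    intro S hS hSb
    obtain ⟨T, hT, hTa, hd, hw⟩ := h S hS hSb
    exact ⟨T, hT, hTa, hd, ih hw (union_subset_union_left hM)⟩

/-- `CanWin` lets Maker claim fewer than `a` elements or repeat her own. Dropping the repetitions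
and padding with arbitrary free elements gives a legal move, and extra elements do no harm. -/
theorem CanWin.exists_reply {k : ℕ} {M B S : Finset X} (h : CanWin board F a b (k + 1) M B)
    (hS : S ⊆ board) (hSb : S.card ≤ b) :
    ∃ T, IsMove a (board \ (M ∪ (B ∪ S))) T ∧ CanWin board F a b k (M ∪ T) (B ∪ S) := by
  obtain ⟨T, hT, hTa, hd, hw⟩ := h S hS hSb
  have hsub : T \ M ⊆ board \ (M ∪ (B ∪ S)) := by
    intro x hx
    rw [mem_sdiff] at hx
    rw [mem_sdiff, mem_union, not_or]
    exact ⟨hT hx.1, hx.2, disjoint_left.1 hd hx.1⟩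
  obtain ⟨R, hTR, hR, hRc⟩ := exists_subsuperset_card_eq (n := min a (board \ (M ∪ (B ∪ S))).card)
    hsub (le_min ((card_le_card sdiff_subset).trans hTa) (card_le_card hsub)) (min_le_right _ _)
  refine ⟨R, ⟨hR, hRc⟩, hw.mono ?_⟩
  intro x hx
  by_cases hxM : x ∈ M
  · exact mem_union_left _ hxM
  · exact mem_union_right _ (hTR (mem_sdiff.2 ⟨(mem_union.1 hx).resolve_left hxM, hxM⟩))

open Classical in
/-- A legal reply of Maker which, if possible, keeps her able to win within `k` further rounds. -/
noncomputable def reply (board : Finset X) (F : Set (Finset X)) (a b k : ℕ) (p : Position X)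
    (S : Finset X) : Finset X :=
  if h : ∃ T, IsMove a ((p.afterBreaker S).free board) T ∧
      CanWin board F a b k (p.maker ∪ T) (p.breaker ∪ S) then h.choose
  else (exists_isMove a ((p.afterBreaker S).free board)).choose

/-- The position reached by always playing `reply` in a game of `t` rounds. -/
noncomputable def replyPosition (board : Finset X) (F : Set (Finset X)) (a b t : ℕ) :
    List (Finset X) → Position X
  | [] => ⟨∅, ∅⟩
  | S :: h =>
    let p := replyPosition board F a b t h
    ⟨p.maker ∪ reply board F a b (t - (h.length + 1)) p S, p.breaker ∪ S⟩

/-- The strategy of always playing `reply` in a game of `t` rounds. -/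
noncomputable def replyStrategy (board : Finset X) (F : Set (Finset X)) (a b t : ℕ) :
    MakerStrategy X
  | [] => ∅
  | S :: h => reply board F a b (t - (h.length + 1)) (replyPosition board F a b t h) S

/-- `replyPosition` has its own recursion so that `replyStrategy` can consult the current position
without circularity; this identifies it with the actual one. -/
theorem position_replyStrategy (t : ℕ) (h : List (Finset X)) :
    position (replyStrategy board F a b t) h = replyPosition board F a b t h := by
  induction h with
  | nil => rfl
  | cons S h ih => simp only [position, replyPosition, replyStrategy, ih]

theorem isMove_reply (k : ℕ) (p : Position X) (S : Finset X) :
    IsMove a ((p.afterBreaker S).free board) (reply board F a b k p S) := by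
  unfold reply
  split_ifs with h
  · exact h.choose_spec.1
  · exact (exists_isMove a ((p.afterBreaker S).free board)).choose_spec

theorem canWin_replyPosition {t : ℕ} (ht : CanWin board F a b t ∅ ∅) (h : List (Finset X))
    (hlen : h.length ≤ t) (hl : BreakerLegal board b (replyStrategy board F a b t) h) :
    CanWin board F a b (t - h.length) (replyPosition board F a b t h).maker
      (replyPosition board F a b t h).breaker := by
  induction h with
  | nil => exact ht
  | cons S h ih =>
    rw [List.length_cons] at hlen
    have hw := ih (by omega) hl.1
    have hS := hl.2
    rw [position_replyStrategy] at hS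
    rw [show t - h.length = t - (h.length + 1) + 1 by omega] at hw
    have hex : ∃ T, IsMove a (((replyPosition board F a b t h).afterBreaker S).free board) T ∧
        CanWin board F a b (t - (h.length + 1)) ((replyPosition board F a b t h).maker ∪ T)
          ((replyPosition board F a b t h).breaker ∪ S) :=
      hw.exists_reply (hS.1.trans sdiff_subset) (hS.2.trans_le (min_le_left _ _))
    simp only [replyPosition, List.length_cons, reply]
    rw [dif_pos hex]
    exact hex.choose_spec.2

theorem CanWin.makerWinsWithin {t : ℕ} (ht : CanWin board F a b t ∅ ∅) :
    MakerWinsWithin board F a b t := by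
  refine ⟨replyStrategy board F a b t, ?_, ?_⟩
  · intro h S _
    rw [position_replyStrategy]
    exact isMove_reply _ _ _
  · intro h hlen hl
    have := canWin_replyPosition ht h hlen.le hl
    rw [hlen, Nat.sub_self] at this
    rw [position_replyStrategy]
    exact this

theorem exists_breakerLegal (board : Finset X) (b : ℕ) (σ : MakerStrategy X) (t : ℕ) :
    ∃ h : List (Finset X), h.length = t ∧ BreakerLegal board b σ h := by
  induction t with
  | zero => exact ⟨[], rfl, trivial⟩
  | succ t ih =>
    obtain ⟨h, hlen, hl⟩ := ih
    obtain ⟨S, hS⟩ := exists_isMove b ((position σ h).free board)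
    exact ⟨S :: h, by simp [hlen], hl, hS⟩

theorem card_maker_le {σ : MakerStrategy X} (hσ : MakerLegal board a b σ) (h : List (Finset X))
    (hl : BreakerLegal board b σ h) : (position σ h).maker.card ≤ a * h.length := by
  induction h with
  | nil => simp [position]
  | cons S h ih =>
    have h1 := ih hl.1
    have h2 := (hσ h S hl).2.trans_le (min_le_left _ _)
    have h3 := card_union_le (position σ h).maker (σ (S :: h))
    simp only [position, List.length_cons, mul_add, mul_one]
    omega

theorem shortestDuration_eq {t : ℕ} (ht : MakerWinsWithin board F a b t)
    (hmin : ∀ s, MakerWinsWithin board F a b s → t ≤ s) :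
    shortestDuration board F a b = t :=
  le_antisymm (iInf₂_le t ht) (le_iInf₂ fun s hs => by exact_mod_cast hmin s hs)

end Strategy

/-! ### Matchings that avoid Breaker's edges. -/

section Matching

variable {V : Type*}

/-- The edges in `M` form a matching that covers exactly the vertices in `W`. -/
structure IsMatchingOn (M : Finset (Sym2 V)) (W : Finset V) : Prop where
  not_isDiag : ∀ e ∈ M, ¬ e.IsDiag
  eq_of_mem : ∀ e ∈ M, ∀ f ∈ M, ∀ v, v ∈ e → v ∈ f → e = f
  mem_iff : ∀ v, v ∈ W ↔ ∃ e ∈ M, v ∈ e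

namespace IsMatchingOn

variable {M M' : Finset (Sym2 V)} {W W' : Finset V}

theorem empty : IsMatchingOn (∅ : Finset (Sym2 V)) ∅ := ⟨by simp, by simp, by simp⟩

theorem mem_left (h : IsMatchingOn M W) {u v : V} (huv : s(u, v) ∈ M) : u ∈ W :=
  (h.mem_iff u).2 ⟨_, huv, Sym2.mem_mk_left _ _⟩

theorem mem_right (h : IsMatchingOn M W) {u v : V} (huv : s(u, v) ∈ M) : v ∈ W :=
  (h.mem_iff v).2 ⟨_, huv, Sym2.mem_mk_right _ _⟩

variable [DecidableEq V]

theorem card_eq (h : IsMatchingOn M W) : W.card = 2 * M.card := by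
  have hW : W = M.biUnion Sym2.toFinset := by
    ext v
    simp [h.mem_iff]
  rw [hW, card_biUnion, sum_congr rfl fun e he => Sym2.card_toFinset_of_not_isDiag e
    (h.not_isDiag e he), sum_const, smul_eq_mul, mul_comm]
  intro e he f hf hef
  rw [Function.onFun, disjoint_left]
  intro v hve hvf
  rw [Sym2.mem_toFinset] at hve hvf
  exact hef (h.eq_of_mem e he f hf v hve hvf)

theorem union (h : IsMatchingOn M W) (h' : IsMatchingOn M' W') (hd : Disjoint W W') :
    IsMatchingOn (M ∪ M') (W ∪ W') := by
  rw [disjoint_left] at hd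
  refine ⟨?_, ?_, ?_⟩
  · intro e he
    exact (mem_union.1 he).elim (h.not_isDiag e) (h'.not_isDiag e)
  · intro e he f hf v hve hvf
    rcases mem_union.1 he with he | he <;> rcases mem_union.1 hf with hf | hf
    · exact h.eq_of_mem e he f hf v hve hvf
    · exact absurd ((h'.mem_iff v).2 ⟨f, hf, hvf⟩) (hd ((h.mem_iff v).2 ⟨e, he, hve⟩))
    · exact absurd ((h'.mem_iff v).2 ⟨e, he, hve⟩) (hd ((h.mem_iff v).2 ⟨f, hf, hvf⟩))
    · exact h'.eq_of_mem e he f hf v hve hvf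
  · intro v
    simp only [mem_union, h.mem_iff, h'.mem_iff, or_and_right, exists_or]

theorem singleton {x y : V} (hxy : x ≠ y) : IsMatchingOn {s(x, y)} {x, y} :=
  ⟨by simpa using hxy, by simp, by simp⟩

theorem insert_edge (h : IsMatchingOn M W) {x y : V} (hxy : x ≠ y) (hx : x ∉ W) (hy : y ∉ W) :
    IsMatchingOn (insert s(x, y) M) (insert x (insert y W)) := by
  have := (singleton hxy).union h (by simp [hx, hy])
  rwa [insert_union, singleton_union, singleton_union] at this

theorem erase_edge (h : IsMatchingOn M W) {u v : V} (huv : s(u, v) ∈ M) :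
    IsMatchingOn (M.erase s(u, v)) ((W.erase v).erase u) := by
  refine ⟨fun e he => h.not_isDiag e (mem_of_mem_erase he), fun e he f hf =>
    h.eq_of_mem e (mem_of_mem_erase he) f (mem_of_mem_erase hf), ?_⟩
  intro w
  simp only [mem_erase, h.mem_iff]
  constructor
  · rintro ⟨h1, h2, e, he, hw⟩
    refine ⟨e, ⟨?_, he⟩, hw⟩
    rintro rfl
    rcases Sym2.mem_iff.1 hw with rfl | rfl <;> contradiction
  · rintro ⟨e, ⟨hne, he⟩, hw⟩
    refine ⟨?_, ?_, e, he, hw⟩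
    · rintro rfl
      exact hne (h.eq_of_mem e he _ huv w hw (Sym2.mem_mk_left _ _))
    · rintro rfl
      exact hne (h.eq_of_mem e he _ huv w hw (Sym2.mem_mk_right _ _))

/-- Replacing the edge `uv` by the edge `xu`, where `x` is an uncovered vertex. -/
theorem shift (h : IsMatchingOn M W) {u v x : V} (huv : s(u, v) ∈ M) (hx : x ∉ W) :
    IsMatchingOn (insert s(x, u) (M.erase s(u, v))) (insert x (W.erase v)) := by
  have huW := h.mem_left huv
  have huv' : u ≠ v := by
    simpa using h.not_isDiag _ huv
  have := (h.erase_edge huv).insert_edge (x := x) (y := u) (by rintro rfl; contradiction)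
    (by simp [hx]) (by simp)
  rwa [insert_erase (mem_erase.2 ⟨huv', huW⟩)] at this

/-- If Breaker has fewer edges than there are covered vertices, some edge `uv` of the matching is
such that `xu` and all edges from `v` to `Y` are not claimed by Breaker. -/
theorem exists_augmenting (h : IsMatchingOn M W) {B : Finset (Sym2 V)} {x : V} {Y : Finset V}
    (hx : x ∉ W) (hxY : x ∉ Y) (hY : Disjoint Y W) (hB : B.card < W.card) :
    ∃ u v, s(u, v) ∈ M ∧ s(x, u) ∉ B ∧ ∀ y ∈ Y, s(y, v) ∉ B := by
  by_contra! hcon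
  rw [disjoint_left] at hY
  -- If every exchange is blocked, each covered `w` with partner `w'` is charged to a Breaker edge
  -- `xw` or `yw'`. As `x` and `Y` lie outside `W` and `x ∉ Y`, the charging is injective, so
  -- `W.card ≤ B.card`.
  have key : ∀ w ∈ W, ∃ w', s(w, w') ∈ M ∧ ∃ e ∈ B, e = s(x, w) ∨ ∃ y ∈ Y, e = s(y, w') := by
    intro w hw
    obtain ⟨e, he, hwe⟩ := (h.mem_iff w).1 hw
    obtain ⟨w', rfl⟩ := hwe
    refine ⟨w', he, ?_⟩
    by_cases hxw : s(x, w) ∈ B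
    · exact ⟨_, hxw, Or.inl rfl⟩
    · obtain ⟨y, hy, hyB⟩ := hcon w w' he hxw
      exact ⟨_, hyB, Or.inr ⟨y, hy, rfl⟩⟩
  have : Nonempty V := ⟨x⟩
  have : Nonempty (Sym2 V) := ⟨s(x, x)⟩
  choose! p hpM f hfB hf using key
  refine hB.not_ge (card_le_card_of_injOn f hfB ?_)
  intro w hw w₁ hw₁ hww
  rw [mem_coe] at hw hw₁
  have hpW := h.mem_right (hpM w hw)
  have hpW₁ := h.mem_right (hpM w₁ hw₁)
  rcases hf w hw with h1 | ⟨y, hy, h1⟩ <;> rcases hf w₁ hw₁ with h2 | ⟨y₁, hy₁, h2⟩ <;>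
    rw [h1, h2] at hww
  · exact Sym2.congr_right.1 hww
  · rcases Sym2.eq_iff.1 hww with ⟨h3, h4⟩ | ⟨h3, h4⟩
    · exact absurd (h3 ▸ hy₁) hxY
    · exact absurd (h3 ▸ hpW₁) hx
  · rcases Sym2.eq_iff.1 hww with ⟨h3, h4⟩ | ⟨h3, h4⟩
    · exact absurd (h3 ▸ hy) hxY
    · exact absurd (h4 ▸ hpW) hx
  · have h5 : p w = p w₁ := by
      rcases Sym2.eq_iff.1 hww with ⟨h3, h4⟩ | ⟨h3, h4⟩
      · exact h4
      · exact absurd (h3 ▸ hpW₁) (hY hy)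
    have h6 := h.eq_of_mem _ (hpM w hw) _ (hpM w₁ hw₁) (p w) (Sym2.mem_mk_right _ _)
      (h5 ▸ Sym2.mem_mk_right _ _)
    rw [← h5] at h6
    exact Sym2.congr_left.1 h6

/-- A matching can be extended to cover `2 * d` further vertices by adding `2 * d` edges that are
not claimed by Breaker. -/
theorem exists_augment (d : ℕ) (h : IsMatchingOn M W) {B : Finset (Sym2 V)} {D : Finset V}
    (hD : D.card = 2 * d) (hDW : Disjoint D W) (hB : B.card < W.card) :
    ∃ T M' : Finset (Sym2 V), T.card ≤ 2 * d ∧ (∀ e ∈ T, ¬ e.IsDiag) ∧ Disjoint T B ∧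
      M' ⊆ M ∪ T ∧ IsMatchingOn M' (W ∪ D) := by
  induction d generalizing M W D with
  | zero =>
    obtain rfl : D = ∅ := by simpa using hD
    exact ⟨∅, M, by simp, by simp, by simp, by simp, by simpa using h⟩
  | succ d ih =>
    obtain ⟨x, hxD⟩ : D.Nonempty := card_pos.1 (by omega)
    obtain ⟨y, hyD⟩ : (D.erase x).Nonempty := card_pos.1 (by rw [card_erase_of_mem hxD]; omega)
    have hyD' := mem_of_mem_erase hyD
    have hyx : y ≠ x := ne_of_mem_erase hyD
    rw [disjoint_left] at hDW
    have hxW := hDW hxD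
    have hyW := hDW hyD'
    -- Exchange along the path `x u v y`: two new edges `xu`, `yv` replace `uv` and cover `x` and
    -- `y`.
    obtain ⟨u, v, huv, hxu, hyv⟩ := h.exists_augmenting (Y := {y}) hxW (by simpa using hyx.symm)
      (by simpa using hyW) hB
    have hyv := hyv y (by simp)
    have hvW := h.mem_right huv
    have huW := h.mem_left huv
    have hne : ∀ {p q : V}, p ∉ W → q ∈ W → p ≠ q := by
      rintro p q hp hq rfl
      exact hp hq
    have h1 := (h.shift huv hxW).insert_edge (x := y) (y := v) (hne hyW hvW)
      (by simp [hyx, hyW]) (by simp [(hne hxW hvW).symm])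
    have hW1 : insert y (insert v (insert x (W.erase v))) = W ∪ {x, y} := by
      ext z
      simp only [mem_insert, mem_erase, mem_union, mem_singleton]
      by_cases hz : z = v
      · subst hz; simp [hvW]
      · simp only [hz]; tauto
    rw [hW1] at h1
    obtain ⟨T, M', hT, hTd, hTB, hM', hm⟩ := ih (D := (D.erase x).erase y) h1
      (by rw [card_erase_of_mem hyD, card_erase_of_mem hxD]; omega)
      (by
        rw [disjoint_left]
        intro z hz
        simp only [mem_erase] at hz
        simp [hDW hz.2.2, hz.1, hz.2.1])
      (hB.trans_le (card_le_card subset_union_left))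
    refine ⟨insert s(x, u) (insert s(y, v) T), M', ?_, ?_, ?_, ?_, ?_⟩
    · have := card_insert_le s(x, u) (insert s(y, v) T)
      have := card_insert_le s(y, v) T
      omega
    · intro e he
      simp only [mem_insert] at he
      rcases he with rfl | rfl | he
      · simpa using hne hxW huW
      · simpa using hne hyW hvW
      · exact hTd e he
    · simp [hxu, hyv, hTB]
    · refine hM'.trans ?_
      intro e he
      simp only [mem_union, mem_insert, mem_erase] at he ⊢
      tauto
    · convert hm using 1
      ext z
      simp only [mem_union, mem_insert, mem_singleton, mem_erase]
      by_cases hzx : z = x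
      · simp [hzx, hxD]
      · by_cases hzy : z = y
        · simp [hzy, hyD']
        · simp [hzx, hzy]

end IsMatchingOn

variable [DecidableEq V]

/-- A vertex of `U` with fewer than `|U| - 1` Breaker edges in `U` has a non-neighbour in `U`. -/
theorem exists_not_adj {U : Finset V} {B : Finset (Sym2 V)} {x : V} (hx : x ∈ U)
    (h : (B ∩ U.sym2).card + 1 < U.card) : ∃ y ∈ U, y ≠ x ∧ s(x, y) ∉ B := by
  by_contra! hcon
  have : (U.erase x).card ≤ (B ∩ U.sym2).card := by
    refine card_le_card_of_injOn (fun y => s(x, y)) ?_ ?_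
    · intro y hy
      rw [mem_coe, mem_erase] at hy
      simp [hcon y hy.2 hy.1, hx, hy.2]
    · intro y _ z _ hyz
      exact Sym2.congr_right.1 hyz
  rw [card_erase_of_mem hx] at this
  omega

theorem inter_sym2_erase_subset (U : Finset V) (B : Finset (Sym2 V)) (x y : V) :
    B ∩ ((U.erase x).erase y).sym2 ⊆ B ∩ U.sym2 := by
  refine inter_subset_inter_left (sym2_mono ?_)
  exact (erase_subset _ _).trans (erase_subset _ _)

theorem notMem_sym2_erase {U : Finset V} {x y z : V} {e : Sym2 V} (hz : z ∈ e)
    (h : z = x ∨ z = y) : e ∉ ((U.erase x).erase y).sym2 := by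
  intro he
  have := mem_sym2_iff.1 he z hz
  simp only [mem_erase] at this
  tauto

/-- If Breaker has at most `j` edges in a set `U` of at least `2 * j + 1` vertices, Maker can match
`2 * j` vertices of `U` by `j` edges so that Breaker has no edge among the other vertices. -/
theorem exists_matching_clearing (j : ℕ) (U : Finset V) (B : Finset (Sym2 V))
    (hB : (B ∩ U.sym2).card ≤ j) (hU : 2 * j + 1 ≤ U.card) :
    ∃ T W, IsMatchingOn T W ∧ W ⊆ U ∧ T.card = j ∧ Disjoint T B ∧ B ∩ (U \ W).sym2 = ∅ := by
  induction j generalizing U with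
  | zero => exact ⟨∅, ∅, .empty, by simp, rfl, by simp, by simpa using hB⟩
  | succ j ih =>
    -- Taking `x` on a Breaker edge, if there is one, ensures that removing `x` destroys at least
    -- one of them.
    obtain ⟨x, hxU, hx⟩ : ∃ x ∈ U, (B ∩ U.sym2).Nonempty → ∃ e ∈ B ∩ U.sym2, x ∈ e := by
      by_cases hne : (B ∩ U.sym2).Nonempty
      · obtain ⟨e, he⟩ := hne
        exact ⟨e.out.1, mem_sym2_iff.1 (mem_inter.1 he).2 _ e.out_fst_mem,
          fun _ => ⟨e, he, e.out_fst_mem⟩⟩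
      · obtain ⟨x, hx⟩ : U.Nonempty := card_pos.1 (by omega)
        exact ⟨x, hx, fun h => absurd h hne⟩
    obtain ⟨y, hyU, hyx, hxy⟩ := exists_not_adj hxU (B := B) (by omega)
    have hyU' : y ∈ U.erase x := mem_erase.2 ⟨hyx, hyU⟩
    obtain ⟨T, W, hT, hW, hTj, hTB, hd⟩ := ih ((U.erase x).erase y)
      (by
        by_cases hne : (B ∩ U.sym2).Nonempty
        · obtain ⟨e, he, hxe⟩ := hx hne
          have : (B ∩ ((U.erase x).erase y).sym2).card < (B ∩ U.sym2).card := by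
            refine card_lt_card ⟨inter_sym2_erase_subset _ _ _ _, fun hs => ?_⟩
            exact notMem_sym2_erase hxe (Or.inl rfl) (mem_inter.1 (hs he)).2
          omega
        · rw [not_nonempty_iff_eq_empty] at hne
          have := card_le_card (inter_sym2_erase_subset U B x y)
          rw [hne, card_empty] at this
          omega)
      (by rw [card_erase_of_mem hyU', card_erase_of_mem hxU]; omega)
    have hxW : x ∉ W := fun h => by simpa using hW h
    have hyW : y ∉ W := fun h => by simpa using hW h
    have hm := hT.insert_edge hyx.symm hxW hyW
    refine ⟨_, _, hm, ?_, ?_, ?_, ?_⟩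
    · intro z hz
      simp only [mem_insert] at hz
      rcases hz with rfl | rfl | hz
      · exact hxU
      · exact hyU
      · exact mem_of_mem_erase (mem_of_mem_erase (hW hz))
    · rw [card_insert_of_notMem, hTj]
      exact fun h => hxW (hT.mem_left h)
    · simp [hxy, hTB]
    · rw [← hd]
      congr 2
      ext z
      simp only [mem_sdiff, mem_insert, mem_erase]
      tauto

/-- A complete graph on `2 * k + 2` vertices from which at most `2 * k` edges have been deleted has
a perfect matching. -/
theorem exists_perfect_matching (k : ℕ) (U : Finset V) (B : Finset (Sym2 V))
    (hB : (B ∩ U.sym2).card ≤ 2 * k) (hU : U.card = 2 * k + 2) :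
    ∃ T, IsMatchingOn T U ∧ Disjoint T B := by
  induction k generalizing U with
  | zero =>
    obtain ⟨x, y, hxy, rfl⟩ := card_eq_two.1 hU
    refine ⟨_, .singleton hxy, ?_⟩
    rw [disjoint_singleton_left]
    intro h
    have : s(x, y) ∈ B ∩ ({x, y} : Finset V).sym2 := by simp [h]
    rw [card_eq_zero.1 (Nat.le_zero.1 hB)] at this
    simp at this
  | succ k ih =>
    -- For the induction it is enough to find a free edge `xy` whose ends meet two Breaker edges, or
    -- one that leaves no Breaker edge at all.
    suffices hs : ∃ x ∈ U, ∃ y ∈ U, y ≠ x ∧ s(x, y) ∉ B ∧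
        (B ∩ ((U.erase x).erase y).sym2).card ≤ 2 * k by
      obtain ⟨x, hxU, y, hyU, hyx, hxy, hc⟩ := hs
      have hyU' : y ∈ U.erase x := mem_erase.2 ⟨hyx, hyU⟩
      obtain ⟨T, hT, hTB⟩ := ih _ hc
        (by rw [card_erase_of_mem hyU', card_erase_of_mem hxU]; omega)
      have hm := hT.insert_edge hyx.symm (by simp) (by simp)
      rw [insert_erase hyU', insert_erase hxU] at hm
      exact ⟨_, hm, by simp [hxy, hTB]⟩
    have hkill : ∀ x y : V, ∀ e ∈ B ∩ U.sym2, ∀ f ∈ B ∩ U.sym2, e ≠ f → (x ∈ e ∨ y ∈ e) →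
        (x ∈ f ∨ y ∈ f) → (B ∩ ((U.erase x).erase y).sym2).card ≤ 2 * k := by
      intro x y e he f hf hef hxe hxf
      have hn : ∀ g, (x ∈ g ∨ y ∈ g) → g ∉ ((U.erase x).erase y).sym2 := by
        rintro g (hg | hg)
        · exact notMem_sym2_erase hg (Or.inl rfl)
        · exact notMem_sym2_erase hg (Or.inr rfl)
      have hsub : B ∩ ((U.erase x).erase y).sym2 ⊆ ((B ∩ U.sym2).erase e).erase f := by
        intro g hg
        refine mem_erase.2 ⟨?_, mem_erase.2 ⟨?_, inter_sym2_erase_subset _ _ _ _ hg⟩⟩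
        · rintro rfl
          exact hn _ hxf (mem_inter.1 hg).2
        · rintro rfl
          exact hn _ hxe (mem_inter.1 hg).2
      have := card_le_card hsub
      rw [card_erase_of_mem (mem_erase.2 ⟨hef.symm, hf⟩), card_erase_of_mem he] at this
      omega
    have hadj : ∀ x ∈ U, ∃ y ∈ U, y ≠ x ∧ s(x, y) ∉ B := fun x hx => exists_not_adj hx (by omega)
    by_cases hone : (B ∩ U.sym2).card ≤ 1
    · obtain ⟨T, W, hT, hWU, hTc, hTB, hc⟩ := exists_matching_clearing 1 U B hone (by omega)
      obtain ⟨e, rfl⟩ := card_eq_one.1 hTc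
      induction e with
      | h x y =>
        have hxy : x ≠ y := by simpa using hT.not_isDiag s(x, y) (by simp)
        have hW : U \ W = (U.erase x).erase y := by
          ext z
          simp [hT.mem_iff]
          tauto
        exact ⟨x, hWU (hT.mem_left (mem_singleton_self _)), y,
          hWU (hT.mem_right (mem_singleton_self _)),
          hxy.symm, by simpa using hTB, by rw [← hW, hc]; simp⟩
    -- If two Breaker edges share `x`, any free edge at `x` works. If they are pairwise disjoint,
    -- join ends of two of them: that edge meets a Breaker edge, so it is free.
    by_cases hsh : ∃ e ∈ B ∩ U.sym2, ∃ f ∈ B ∩ U.sym2, e ≠ f ∧ ∃ x, x ∈ e ∧ x ∈ f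
    · obtain ⟨e, he, f, hf, hef, x, hxe, hxf⟩ := hsh
      have hxU := mem_sym2_iff.1 (mem_inter.1 he).2 x hxe
      obtain ⟨y, hyU, hyx, hxy⟩ := hadj x hxU
      exact ⟨x, hxU, y, hyU, hyx, hxy, hkill x y e he f hf hef (Or.inl hxe) (Or.inl hxf)⟩
    · push Not at hsh
      obtain ⟨e, he, f, hf, hef⟩ := one_lt_card.1 (not_le.1 hone)
      have hx := e.out_fst_mem
      have hy := f.out_fst_mem
      set x := e.out.1
      set y := f.out.1
      have hxU := mem_sym2_iff.1 (mem_inter.1 he).2 x hx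
      have hyU := mem_sym2_iff.1 (mem_inter.1 hf).2 y hy
      have hye : y ∉ e := fun h => hsh e he f hf hef y h hy
      refine ⟨x, hxU, y, hyU, ?_, ?_, hkill x y e he f hf hef (Or.inl hx) (Or.inr hy)⟩
      · rintro h
        exact hye (h ▸ hx)
      · intro hxy
        refine hsh e he s(x, y) (by simp [hxy, hxU, hyU]) ?_ x hx (Sym2.mem_mk_left _ _)
        intro h
        exact hye (h ▸ Sym2.mem_mk_right _ _)

/-- A complete graph on `2 * k ≥ 4` vertices is not covered by `2 * k - 1` edges. -/
theorem exists_free_pair {k : ℕ} (hk : 2 ≤ k) (U : Finset V) (B : Finset (Sym2 V))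
    (hB : (B ∩ U.sym2).card + 1 ≤ 2 * k) (hU : U.card = 2 * k) :
    ∃ x ∈ U, ∃ y ∈ U, x ≠ y ∧ s(x, y) ∉ B := by
  by_contra! hcon
  have hsub : U.offDiag.image Sym2.mk.uncurry ⊆ B ∩ U.sym2 := by
    intro e he
    obtain ⟨⟨x, y⟩, hxy, rfl⟩ := mem_image.1 he
    rw [mem_offDiag] at hxy
    simp [hcon x hxy.1 y hxy.2.1 hxy.2.2, hxy.1, hxy.2.1]
  have h1 := card_le_card hsub
  have h2 := Sym2.two_mul_card_image_offDiag U
  rw [offDiag_card, hU] at h2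
  have h3 : 4 * (2 * k) ≤ 2 * k * (2 * k) := Nat.mul_le_mul_right _ (by omega)
  omega

end Matching

/-! ### Maker's strategies in the perfect matching game. -/

section PerfectMatchingGame

variable {n : ℕ}

theorem mem_completeEdges {e : Sym2 (Fin n)} : e ∈ completeEdges n ↔ ¬ e.IsDiag := by
  simp [completeEdges]

theorem mk_mem_completeEdges {x y : Fin n} : s(x, y) ∈ completeEdges n ↔ x ≠ y := by
  simp [mem_completeEdges]

theorem IsMatchingOn.mem_perfectMatchings {M : Finset (Sym2 (Fin n))} {W : Finset (Fin n)}
    (h : IsMatchingOn M W) (hW : W.card = 2 * (n / 2)) : M ∈ perfectMatchings n := by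
  refine ⟨fun e he => mem_completeEdges.2 (h.not_isDiag e he), ?_, ?_⟩
  · rintro e he f hf hef v ⟨hve, hvf⟩
    exact hef (h.eq_of_mem e he f hf v hve hvf)
  · have := h.card_eq
    omega

theorem exists_isMatchingOn_of_mem_perfectMatchings {M : Finset (Sym2 (Fin n))}
    (h : M ∈ perfectMatchings n) : ∃ W, IsMatchingOn M W := by
  refine ⟨univ.filter fun v => ∃ e ∈ M, v ∈ e, fun e he => mem_completeEdges.1 (h.1 he), ?_,
    by simp⟩
  intro e he f hf v hve hvf
  by_contra hef
  exact h.2.1 e he f hf hef v ⟨hve, hvf⟩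

/-- After `j` rounds Maker has matched `2 * a * j` vertices, and Breaker has no edge among the
remaining vertices. -/
structure IsClear (a j : ℕ) (M B : Finset (Sym2 (Fin n))) : Prop where
  matching : ∃ M₀ ⊆ M, ∃ W, IsMatchingOn M₀ W ∧ W.card = 2 * (a * j) ∧ B ∩ (univ \ W).sym2 = ∅
  card_le : B.card ≤ a * j

theorem isClear_zero (a : ℕ) : IsClear a 0 (∅ : Finset (Sym2 (Fin n))) ∅ :=
  ⟨⟨∅, by simp, ∅, .empty, by simp, by simp⟩, by simp⟩

theorem card_union_inter_le {α : Type*} [DecidableEq α] {B S Q : Finset α} (h : B ∩ Q = ∅) :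
    ((B ∪ S) ∩ Q).card ≤ S.card := by
  rw [union_inter_distrib_right, h, empty_union]
  exact card_le_card inter_subset_left

/-- All Breaker edges among the uncovered vertices come from his latest move, so there are at most
`a`, as `exists_matching_clearing` requires. -/
theorem IsClear.exists_reply {a j : ℕ} {M B S : Finset (Sym2 (Fin n))} (h : IsClear a j M B)
    (hn : 2 * (a * (j + 1)) + 1 ≤ n) (hSa : S.card ≤ a) :
    ∃ T ⊆ completeEdges n, T.card ≤ a ∧ Disjoint T (B ∪ S) ∧
      IsClear a (j + 1) (M ∪ T) (B ∪ S) := by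
  obtain ⟨⟨M₀, hM₀, W, hm, hW, hB⟩, hc⟩ := h
  rw [mul_add, mul_one] at hn
  obtain ⟨T, W', hT, hW', hTa, hTd, hclear⟩ := exists_matching_clearing a (univ \ W) (B ∪ S)
    ((card_union_inter_le hB).trans hSa)
    (by rw [card_sdiff_of_subset (subset_univ _), card_univ, Fintype.card_fin]; omega)
  have hdisj : Disjoint W W' := by
    rw [disjoint_left]
    intro v hv hv'
    exact (mem_sdiff.1 (hW' hv')).2 hv
  refine ⟨T, fun e he => mem_completeEdges.2 (hT.not_isDiag e he), hTa.le, hTd,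
    ⟨M₀ ∪ T, union_subset_union_left hM₀, W ∪ W', hm.union hT hdisj, ?_, ?_⟩,
    ?_⟩
  · rw [card_union_of_disjoint hdisj, hW, hT.card_eq, hTa]
    ring
  · rw [← hclear]
    congr 2
    ext v
    simp
  · have := card_union_le B S
    rw [mul_add, mul_one]
    omega

theorem IsClear.canWin {a i j k : ℕ} (hn : 2 * (a * (j + i)) + 1 ≤ n)
    (hend : ∀ M B : Finset (Sym2 (Fin n)), IsClear a (j + i) M B →
      CanWin (completeEdges n) (perfectMatchings n) a a k M B)
    {M B : Finset (Sym2 (Fin n))} (h : IsClear a j M B) :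
    CanWin (completeEdges n) (perfectMatchings n) a a (k + i) M B := by
  induction i generalizing j M B with
  | zero => exact hend M B h
  | succ i ih =>
    intro S _ hSa
    rw [show j + (i + 1) = j + 1 + i by ring] at hn hend
    have hle : 2 * (a * (j + 1)) ≤ 2 * (a * (j + 1 + i)) :=
      Nat.mul_le_mul_left 2 (Nat.mul_le_mul_left a (Nat.le_add_right _ _))
    obtain ⟨T, hT, hTa, hTd, hc⟩ := h.exists_reply (by omega) hSa
    exact ⟨T, hT, hTa, hTd, ih hn hend hc⟩

/-- Breaker having at most `a` edges among `2 * k` uncovered vertices, `a` new edges suffice to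
extend a large matching to these vertices. -/
theorem exists_extension {V : Type*} [DecidableEq V] {a k : ℕ} (ha : 2 ≤ a) (hka : k ≤ a)
    {M B : Finset (Sym2 V)} {W U : Finset V} (hm : IsMatchingOn M W) (hU : U.card = 2 * k)
    (hUW : Disjoint U W) (hB : (B ∩ U.sym2).card ≤ a)
    (hBW : B.card < W.card) :
    ∃ T M' : Finset (Sym2 V), T.card ≤ a ∧ (∀ e ∈ T, ¬ e.IsDiag) ∧ Disjoint T B ∧
      M' ⊆ M ∪ T ∧ IsMatchingOn M' (W ∪ U) := by
  -- If `2 * k ≤ a`, exchanges alone are affordable. If `2 * k = a + 1`, one free pair saves the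
  -- missing edge. If `2 * k ≥ a + 2`, Breaker has at most `2 * (k - 1)` edges and `U` has a perfect
  -- matching.
  rcases le_or_gt (2 * k) a with h1 | h1
  · obtain ⟨T, M', hT, hrest⟩ := hm.exists_augment k hU hUW hBW
    exact ⟨T, M', hT.trans h1, hrest⟩
  rcases le_or_gt (2 * k) (a + 1) with h2 | h2
  · obtain ⟨x, hx, y, hy, hxy, hxyB⟩ := exists_free_pair (k := k) (by omega) U B (by omega) hU
    rw [disjoint_left] at hUW
    have hm1 := hm.insert_edge hxy (hUW hx) (hUW hy)
    have hy' : y ∈ U.erase x := mem_erase.2 ⟨hxy.symm, hy⟩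
    obtain ⟨T, M', hT, hTd, hTB, hM', hm'⟩ := hm1.exists_augment (k - 1) (B := B)
      (D := (U.erase x).erase y)
      (by rw [card_erase_of_mem hy', card_erase_of_mem hx]; omega)
      (by
        rw [disjoint_left]
        intro z hz
        simp only [mem_erase] at hz
        simp [hz.1, hz.2.1, hUW hz.2.2])
      (hBW.trans_le (card_le_card ((subset_insert _ _).trans (subset_insert _ _))))
    refine ⟨insert s(x, y) T, M', ?_, ?_, ?_, ?_, ?_⟩
    · have := card_insert_le s(x, y) T
      omega
    · intro e he
      rcases mem_insert.1 he with rfl | he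
      · simpa using hxy
      · exact hTd e he
    · simp [hxyB, hTB]
    · refine hM'.trans ?_
      intro e he
      simp only [mem_union, mem_insert] at he ⊢
      tauto
    · convert hm' using 1
      ext z
      simp only [mem_union, mem_insert, mem_erase]
      by_cases hzx : z = x
      · simp [hzx, hx]
      · by_cases hzy : z = y
        · simp [hzy, hy]
        · simp [hzx, hzy]
  · obtain ⟨T, hT, hTB⟩ := exists_perfect_matching (k - 1) U B (by omega) (by omega)
    have := hT.card_eq
    exact ⟨T, M ∪ T, by omega, hT.not_isDiag, hTB, Subset.rfl, hm.union hT hUW.symm⟩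

theorem IsClear.canWin_one {a j : ℕ} (ha : 2 ≤ a) (hj : 2 ≤ j) (hn : a * j ≤ n / 2)
    (hn' : n / 2 ≤ a * (j + 1)) {M B : Finset (Sym2 (Fin n))} (h : IsClear a j M B) :
    CanWin (completeEdges n) (perfectMatchings n) a a 1 M B := by
  intro S _ hSa
  obtain ⟨⟨M₀, hM₀, W, hm, hW, hB⟩, hc⟩ := h
  rw [mul_add, mul_one] at hn'
  have hcard : (univ \ W).card = n - 2 * (a * j) := by
    rw [card_sdiff_of_subset (subset_univ _), card_univ, Fintype.card_fin, hW]
  -- For odd `n` one uncovered vertex is left out of `U`.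
  obtain ⟨U, hU, hUc⟩ := exists_subset_card_eq (s := univ \ W) (n := 2 * (n / 2 - a * j))
    (by omega)
  have hUW : Disjoint U W := disjoint_left.2 fun v hv => (mem_sdiff.1 (hU hv)).2
  obtain ⟨T, M', hT, hTd, hTB, hM', hm'⟩ := exists_extension (k := n / 2 - a * j) (B := B ∪ S) ha
    (by omega) hm hUc hUW
    ((card_le_card (inter_subset_inter_left (sym2_mono hU))).trans
      ((card_union_inter_le hB).trans hSa))
    -- Exchanges need `B ∪ S`, of size at most `a * j + a`, to be smaller than `W`, of size `2 * a *
    -- j`; hence `2 ≤ j`.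
    (by
      have := card_union_le B S
      have : a * 2 ≤ a * j := Nat.mul_le_mul_left a hj
      omega)
  refine ⟨T, fun e he => mem_completeEdges.2 (hTd e he), hT, hTB, M', ?_,
    hM'.trans (union_subset_union_left hM₀)⟩
  apply hm'.mem_perfectMatchings
  rw [card_union_of_disjoint hUW.symm, hUc, hW]
  omega

theorem canWin_two_le {a : ℕ} (ha : 2 ≤ a) (hn : 4 * a + 2 ≤ n) :
    CanWin (completeEdges n) (perfectMatchings n) a a ((n / 2 + a - 1) / a) ∅ ∅ := by
  have h1 : a * ((n / 2 - 1) / a) ≤ n / 2 - 1 := Nat.mul_div_le _ _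
  have h2 : n / 2 - 1 < a * ((n / 2 - 1) / a + 1) := Nat.lt_mul_div_succ _ (by omega)
  have h3 : 2 ≤ (n / 2 - 1) / a := (Nat.le_div_iff_mul_le (by omega)).2 (by omega)
  have h4 : (n / 2 + a - 1) / a = 1 + (n / 2 - 1) / a := by
    -- Subtracting 1 before dividing by `a` leaves between 1 and `a` pairs for the final round.
    rw [show n / 2 + a - 1 = n / 2 - 1 + a by omega, Nat.add_div_right _ (by omega), add_comm]
  rw [h4]
  refine IsClear.canWin (j := 0) ?_ (fun M B h => ?_) (isClear_zero a)
  · rw [zero_add]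
    omega
  · rw [zero_add] at h
    exact h.canWin_one ha h3 (by omega) (by omega)

/-- The vertex left over at the end is the spare one that clearing needs, so every round can be a
clearing round. -/
theorem canWin_one_odd (hn : Odd n) :
    CanWin (completeEdges n) (perfectMatchings n) 1 1 (n / 2) ∅ ∅ := by
  obtain ⟨m, rfl⟩ := hn
  rw [← zero_add ((2 * m + 1) / 2)]
  refine IsClear.canWin (j := 0) (by omega) (fun M B h => ?_) (isClear_zero 1)
  obtain ⟨M₀, hM₀, W, hm, hW, -⟩ := h.matching
  exact ⟨M₀, hm.mem_perfectMatchings (by omega), hM₀⟩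

/-- Maker can win by claiming one edge, as she has two disjoint options to complete a perfect
matching. -/
theorem canWin_one_of_double_threat (hn : Even n) {M B M₁ M₂ : Finset (Sym2 (Fin n))}
    {W₁ W₂ : Finset (Fin n)} {q x v : Fin n} (hM₁ : M₁ ⊆ M) (hM₂ : M₂ ⊆ M)
    (h₁ : IsMatchingOn M₁ W₁) (h₂ : IsMatchingOn M₂ W₂) (hW₁ : W₁.card + 2 = n)
    (hW₂ : W₂.card + 2 = n) (hx : x ∉ W₁) (hq₁ : q ∉ W₁) (hv : v ∉ W₂) (hq₂ : q ∉ W₂)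
    (hxq : x ≠ q) (hvq : v ≠ q) (hxv : x ≠ v) (hxB : s(x, q) ∉ B) (hvB : s(v, q) ∉ B) :
    CanWin (completeEdges n) (perfectMatchings n) 1 1 1 M B := by
  have claim : ∀ (S M₀ : Finset (Sym2 (Fin n))) (W : Finset (Fin n)) (z : Fin n), M₀ ⊆ M →
      IsMatchingOn M₀ W → W.card + 2 = n → z ∉ W → q ∉ W → z ≠ q → s(z, q) ∉ B → s(z, q) ∉ S →
      ∃ T ⊆ completeEdges n, T.card ≤ 1 ∧ Disjoint T (B ∪ S) ∧
        CanWin (completeEdges n) (perfectMatchings n) 1 1 0 (M ∪ T) (B ∪ S) := by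
    intro S M₀ W z hM₀ hm hW hz hq hzq hzB hzS
    refine ⟨{s(z, q)}, by simpa [mk_mem_completeEdges] using hzq, by simp, by simp [hzB, hzS],
      insert s(z, q) M₀, (hm.insert_edge hzq hz hq).mem_perfectMatchings ?_, ?_⟩
    · rw [card_insert_of_notMem (by simp [hz, hzq]), card_insert_of_notMem hq]
      obtain ⟨m, rfl⟩ := hn
      omega
    · rw [union_comm, ← insert_eq]
      exact insert_subset_insert _ hM₀
  intro S _ hSc
  by_cases hxS : s(x, q) ∈ S
  · refine claim S M₂ W₂ v hM₂ h₂ hW₂ hv hq₂ hvq hvB fun hvS => hxv ?_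
    exact Sym2.congr_left.1 (card_le_one.1 hSc _ hxS _ hvS)
  · exact claim S M₁ W₁ x hM₁ h₁ hW₁ hx hq₁ hxq hxB hxS

/-- One matching misses `x, y, z, w`, the other `v, y, z, w`. Maker plays `yz` and threatens `xw`
and `vw`, or plays `yw` and threatens `xz` and `vz`. These triples are disjoint, so Breaker's single
edge spoils at most one plan. -/
theorem canWin_two_of_double_threat (hn : Even n) {M B M₁ M₂ : Finset (Sym2 (Fin n))}
    {W₁ W₂ : Finset (Fin n)} {x y z w v : Fin n} (hM₁ : M₁ ⊆ M) (hM₂ : M₂ ⊆ M)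
    (h₁ : IsMatchingOn M₁ W₁) (h₂ : IsMatchingOn M₂ W₂) (hW₁ : W₁.card + 4 = n)
    (hW₂ : W₂.card + 4 = n) (hd : [x, v, y, z, w].Nodup)
    (hx : x ∉ W₁) (hy₁ : y ∉ W₁) (hz₁ : z ∉ W₁) (hw₁ : w ∉ W₁)
    (hv : v ∉ W₂) (hy₂ : y ∉ W₂) (hz₂ : z ∉ W₂) (hw₂ : w ∉ W₂)
    (hyz : s(y, z) ∉ B) (hyw : s(y, w) ∉ B) (hxz : s(x, z) ∉ B) (hxw : s(x, w) ∉ B)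
    (hvz : s(v, z) ∉ B) (hvw : s(v, w) ∉ B) :
    CanWin (completeEdges n) (perfectMatchings n) 1 1 2 M B := by
  simp only [List.nodup_cons, List.mem_cons, List.not_mem_nil, or_false, not_or, not_false_eq_true,
    List.nodup_nil, and_true] at hd
  obtain ⟨⟨dxv, dxy, dxz, dxw⟩, ⟨dvy, dvz, dvw⟩, ⟨dyz, dyw⟩, dzw⟩ := hd
  have claim : ∀ (S : Finset (Sym2 (Fin n))) (p q : Fin n), y ≠ p → y ≠ q → p ≠ q → x ≠ p → v ≠ p →
      x ≠ q → v ≠ q → p ∉ W₁ → q ∉ W₁ → p ∉ W₂ → q ∉ W₂ →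
      s(y, p) ∉ B → s(x, q) ∉ B → s(v, q) ∉ B → s(y, p) ∉ S → s(x, q) ∉ S → s(v, q) ∉ S →
      ∃ T ⊆ completeEdges n, T.card ≤ 1 ∧ Disjoint T (B ∪ S) ∧
        CanWin (completeEdges n) (perfectMatchings n) 1 1 1 (M ∪ T) (B ∪ S) := by
    intro S p q hyp hyq hpq hxp hvp hxq hvq hp₁ hq₁ hp₂ hq₂ b1 b2 b3 s1 s2 s3
    have hins : ∀ M₀ ⊆ M, insert s(y, p) M₀ ⊆ M ∪ {s(y, p)} := by
      intro M₀ hM₀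
      rw [union_comm, ← insert_eq]
      exact insert_subset_insert _ hM₀
    have hcard : ∀ W : Finset (Fin n), y ∉ W → p ∉ W → W.card + 4 = n →
        (insert y (insert p W)).card + 2 = n := by
      intro W hy hp hW
      rw [card_insert_of_notMem (by simp [hy, hyp]), card_insert_of_notMem hp]
      omega
    refine ⟨{s(y, p)}, by simpa [mk_mem_completeEdges] using hyp, by simp, by simp [b1, s1], ?_⟩
    exact canWin_one_of_double_threat hn (hins _ hM₁) (hins _ hM₂) (h₁.insert_edge hyp hy₁ hp₁)
      (h₂.insert_edge hyp hy₂ hp₂) (hcard _ hy₁ hp₁ hW₁) (hcard _ hy₂ hp₂ hW₂)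
      (q := q) (x := x) (v := v) (by simp [dxy, hxp, hx]) (by simp [hyq.symm, hpq.symm, hq₁])
      (by simp [dvy, hvp, hv]) (by simp [hyq.symm, hpq.symm, hq₂]) hxq hvq dxv
      (by simp [b2, s2]) (by simp [b3, s3])
  intro S _ hSc
  by_cases hS' : s(y, z) ∉ S ∧ s(x, w) ∉ S ∧ s(v, w) ∉ S
  · exact claim S z w dyz dyw dzw dxz dvz dxw dvw hz₁ hw₁ hz₂ hw₂ hyz hxw hvw hS'.1 hS'.2.1 hS'.2.2
  · have hone : ∀ e ∈ S, ∀ f ∈ S, e = f := card_le_one.1 hSc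
    have key : ∃ e ∈ S, e = s(y, z) ∨ e = s(x, w) ∨ e = s(v, w) := by
      by_contra! hcon
      exact hS' ⟨fun h => (hcon _ h).1 rfl, fun h => (hcon _ h).2.1 rfl,
        fun h => (hcon _ h).2.2 rfl⟩
    obtain ⟨e, he, hee⟩ := key
    have hnot : ∀ f, e ≠ f → f ∉ S := fun f hef hf => hef (hone e he f hf)
    refine claim S w z dyw dyz (Ne.symm dzw) dxw dvw dxz dvz hw₁ hz₁ hw₂ hz₂ hyw hxz hvz
      (hnot _ ?_) (hnot _ ?_) (hnot _ ?_) <;> rcases hee with rfl | rfl | rfl <;>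
      simp [dxy, dxz, dxw, dvy, dvz, dvw, dyz, dyw, dzw, Ne.symm dxv, Ne.symm dxy, Ne.symm dvy,
        Ne.symm dxz, Ne.symm dxw, Ne.symm dvz, Ne.symm dvw, Ne.symm dyz, Ne.symm dzw]

/-- Among the four uncovered vertices only one edge, `xy`, can be Breaker's. Maker claims `xu` for a
matching edge `uv`: she may then regard either `x` or `v` as uncovered, which sets up the double
threat. Finding `u` and `v` needs `j + 1 < 2 * j`. -/
theorem IsClear.canWin_three {j : ℕ} (hn : n = 2 * j + 4) (hj : 2 ≤ j)
    {M B : Finset (Sym2 (Fin n))} (h : IsClear 1 j M B) :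
    CanWin (completeEdges n) (perfectMatchings n) 1 1 3 M B := by
  intro S hS hSc
  obtain ⟨⟨M₀, hM₀, W, hm, hW, hB⟩, hc⟩ := h
  have hcard : (univ \ W).card = 4 := by
    rw [card_sdiff_of_subset (subset_univ _), card_univ, Fintype.card_fin, hW]
    omega
  obtain ⟨x, y, hx, hy, hxy, hxyS⟩ : ∃ x y, x ∉ W ∧ y ∉ W ∧ x ≠ y ∧
      ∀ p ∉ W, ∀ q ∉ W, s(p, q) ∈ S → s(p, q) = s(x, y) := by
    by_cases hne : ∃ x y, x ∉ W ∧ y ∉ W ∧ s(x, y) ∈ S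
    · obtain ⟨x, y, hx, hy, hxy⟩ := hne
      exact ⟨x, y, hx, hy, mk_mem_completeEdges.1 (hS hxy), fun p _ q _ hpq =>
        card_le_one.1 hSc _ hpq _ hxy⟩
    · obtain ⟨x, hx, y, hy, hxy⟩ := one_lt_card.1 (show 1 < (univ \ W).card by omega)
      exact ⟨x, y, (mem_sdiff.1 hx).2, (mem_sdiff.1 hy).2, hxy, fun p hp q hq hpq =>
        absurd ⟨p, q, hp, hq, hpq⟩ hne⟩
  have hyx : y ∈ (univ \ W).erase x := by simp [hxy.symm, hy]
  obtain ⟨z, w, hzw, hU⟩ := card_eq_two.1 (show (((univ \ W).erase x).erase y).card = 2 by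
    rw [card_erase_of_mem hyx, card_erase_of_mem (by simpa using hx), hcard])
  have hz : z ∈ ((univ \ W).erase x).erase y := by simp [hU]
  have hw : w ∈ ((univ \ W).erase x).erase y := by simp [hU]
  simp only [mem_erase, mem_sdiff, mem_univ, true_and] at hz hw
  obtain ⟨hzy, hzx, hz⟩ := hz
  obtain ⟨hwy, hwx, hw⟩ := hw
  obtain ⟨u, v, huv, hxu, hvY⟩ := hm.exists_augmenting (B := B ∪ S) (Y := {y, z, w}) hx
    (by simp [hxy, hzx.symm, hwx.symm]) (by simp [hy, hz, hw])
    (by have := card_union_le B S; omega)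
  have hvW := hm.mem_right huv
  have huW := hm.mem_left huv
  have hne : ∀ {p q : Fin n}, p ∉ W → q ∈ W → p ≠ q := by
    rintro p q hp hq rfl
    exact hp hq
  have hfree : ∀ p ∉ W, ∀ q ∉ W, s(p, q) ≠ s(x, y) → s(p, q) ∉ B ∪ S := by
    intro p hp q hq hpq hmem
    rcases mem_union.1 hmem with h1 | h1
    · have : s(p, q) ∈ B ∩ (univ \ W).sym2 := by simp [h1, hp, hq]
      rw [hB] at this
      simp at this
    · exact hpq (hxyS p hp q hq h1)
  refine ⟨{s(x, u)}, by simpa [mk_mem_completeEdges] using hne hx huW, by simp,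
    by simpa using hxu, ?_⟩
  refine canWin_two_of_double_threat (hn ▸ ⟨j + 2, by ring⟩) (M₁ := M₀)
    (M₂ := insert s(x, u) (M₀.erase s(u, v))) (x := x) (y := y) (z := z) (w := w) (v := v)
    (hM₀.trans subset_union_left) ?_ hm (hm.shift huv hx) (by omega) ?_ ?_ hx hy hz hw ?_ ?_ ?_ ?_
    ?_ ?_ ?_ ?_ ?_ ?_
  · rw [union_comm, ← insert_eq]
    exact insert_subset_insert _ ((erase_subset _ _).trans hM₀)
  · rw [card_insert_of_notMem (by simp [hx]), card_erase_of_mem hvW]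
    omega
  · simp [hne hx hvW, hxy, hzx.symm, hwx.symm, (hne hy hvW).symm, (hne hz hvW).symm,
      (hne hw hvW).symm, hzy.symm, hwy.symm, hzw]
  · simp [(hne hx hvW).symm]
  · simp [hxy.symm, hy]
  · simp [hzx, hz]
  · simp [hwx, hw]
  · exact hfree y hy z hz (by simp [hxy.symm, hzx])
  · exact hfree y hy w hw (by simp [hxy.symm, hwx])
  · exact hfree x hx z hz (by simp [hzy, hxy])
  · exact hfree x hx w hw (by simp [hwy, hxy])
  · rw [Sym2.eq_swap]
    exact hvY z (by simp)
  · rw [Sym2.eq_swap]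
    exact hvY w (by simp)

theorem canWin_one_even (hn : Even n) (hn8 : 8 ≤ n) :
    CanWin (completeEdges n) (perfectMatchings n) 1 1 (n / 2 + 1) ∅ ∅ := by
  obtain ⟨m, rfl⟩ := hn
  rw [show (m + m) / 2 + 1 = 3 + (m - 2) by omega]
  refine IsClear.canWin (j := 0) (by omega) (fun M B h => ?_) (isClear_zero 1)
  rw [zero_add] at h
  exact h.canWin_three (by omega) (by omega)

/-! ### Lower bounds. -/

theorem half_le_of_makerWinsWithin {a b t : ℕ}
    (h : MakerWinsWithin (completeEdges n) (perfectMatchings n) a b t) : n / 2 ≤ a * t := by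
  obtain ⟨σ, hσ, hwin⟩ := h
  obtain ⟨l, rfl, hl⟩ := exists_breakerLegal (completeEdges n) b σ t
  obtain ⟨W, hW, hWM⟩ := hwin l rfl hl
  rw [← hW.2.2]
  exact (card_le_card hWM).trans (card_maker_le hσ l hl)

/-- If a set of edges is completed to a perfect matching of an even number of vertices by each of
two edges, then these edges agree. -/
theorem eq_of_insert_mem_perfectMatchings (hn : Even n) {M : Finset (Sym2 (Fin n))}
    {e f : Sym2 (Fin n)} (heM : e ∉ M) (he : insert e M ∈ perfectMatchings n)
    (hf : insert f M ∈ perfectMatchings n) : e = f := by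
  obtain ⟨W, hW⟩ := exists_isMatchingOn_of_mem_perfectMatchings hf
  have hWu : W = univ := by
    rw [← card_eq_iff_eq_univ, hW.card_eq, hf.2.2, Fintype.card_fin]
    obtain ⟨m, rfl⟩ := hn
    omega
  -- An end of `e` not on `f` would be covered by an edge of `M`, which would then meet `e` in the
  -- first matching.
  have hv : ∀ v ∈ e, v ∈ f := by
    intro v hve
    obtain ⟨g, hg, hvg⟩ := (hW.mem_iff v).1 (hWu ▸ mem_univ v)
    rcases mem_insert.1 hg with rfl | hg
    · exact hvg
    · refine absurd ⟨hve, hvg⟩ (he.2.1 e (mem_insert_self _ _) g (mem_insert_of_mem hg) ?_ v)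
      rintro rfl
      exact heM hg
  induction e with
  | h x y =>
    have hxy : x ≠ y := mk_mem_completeEdges.1 (he.1 (mem_insert_self _ _))
    exact ((Sym2.mem_and_mem_iff hxy).1 ⟨hv x (Sym2.mem_mk_left _ _),
      hv y (Sym2.mem_mk_right _ _)⟩).symm

theorem not_makerWinsWithin_half (hn : Even n) (hn2 : 2 ≤ n) :
    ¬ MakerWinsWithin (completeEdges n) (perfectMatchings n) 1 1 (n / 2) := by
  rintro ⟨σ, hσ, hwin⟩
  obtain ⟨l, hlen, hl⟩ := exists_breakerLegal (completeEdges n) 1 σ (n / 2 - 1)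
  have hc := card_maker_le hσ l hl
  set p := position σ l with hp
  -- Maker has at most `n / 2 - 1` edges before the last round, so all of them and exactly one new
  -- edge form the matching.
  have fin : ∀ S, BreakerLegal (completeEdges n) 1 σ (S :: l) → ∃ f ∈ completeEdges n,
      f ∉ p.maker ∧ f ∉ p.breaker ∧ f ∉ S ∧ insert f p.maker ∈ perfectMatchings n := by
    intro S hS
    obtain ⟨W, hW, hWM⟩ := hwin (S :: l) (by simp [hlen]; omega) hS
    have hmove := hσ l S hS
    rw [← hp] at hmove
    have hT := hmove.2.trans_le (min_le_left _ _)
    simp only [position, ← hp] at hWM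
    have h1 := card_le_card hWM
    have h2 := card_union_le p.maker (σ (S :: l))
    rw [hW.2.2] at h1
    have hWeq : W = p.maker ∪ σ (S :: l) := eq_of_subset_of_card_le hWM (by rw [hW.2.2]; omega)
    obtain ⟨f, hf⟩ := card_eq_one.1 (show (σ (S :: l)).card = 1 by omega)
    rw [hf] at hmove hWeq
    have hfm := hmove.1 (mem_singleton_self f)
    simp only [Position.free, Position.afterBreaker, mem_sdiff, mem_union, not_or] at hfm
    rw [union_comm, ← insert_eq] at hWeq
    exact ⟨f, hfm.1, hfm.2.1, hfm.2.2.1, hfm.2.2.2, hWeq ▸ hW⟩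
  -- An arbitrary last move of Breaker reveals the missing edge `e`; replaying that round with `{e}`
  -- refutes the strategy.
  obtain ⟨S₀, hS₀⟩ := exists_isMove 1 (p.free (completeEdges n))
  obtain ⟨e, heb, heM, heB, -, he⟩ := fin S₀ ⟨hl, hS₀⟩
  have hefree : e ∈ p.free (completeEdges n) := by simp [Position.free, heb, heM, heB]
  obtain ⟨f, -, -, -, hfe, hf⟩ := fin {e} ⟨hl, by simpa [← hp] using hefree, by
    rw [card_singleton, ← hp]
    exact (min_eq_left (card_pos.2 ⟨e, hefree⟩)).symm⟩
  exact hfe (by simp [eq_of_insert_mem_perfectMatchings hn heM he hf])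

end PerfectMatchingGame

/-! ### Arithmetic of the closed formula. -/

theorem ceil_div_eq {c d n : ℕ} (h1 : d * c < n) (h2 : n ≤ d * (c + 1)) :
    ⌈(n : ℚ) / (d : ℚ)⌉₊ = c + 1 := by
  have hd : (0 : ℚ) < d := by
    rcases Nat.eq_zero_or_pos d with rfl | hd
    · omega
    · exact_mod_cast hd
  rw [Nat.ceil_eq_iff (by omega), lt_div_iff₀ hd, div_le_iff₀ hd, mul_comm, mul_comm _ (d : ℚ),
    Nat.add_sub_cancel]
  exact ⟨by exact_mod_cast h1, by exact_mod_cast h2⟩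

/-- With `n = 2 * (a * c) + r + 1` and `r < 2 * a`, the right-hand ceiling is `c + 1`, while `n / 2`
exceeds `a * c` by `(r + 1) / 2`. This excess is 0 exactly when `r = 0` and is never more than `a`.
-/
theorem ceil_half_div_eq {a n : ℕ} (ha : 1 ≤ a) (hn : 2 ≤ n) :
    (n / 2 + a - 1) / a = if 2 * a ∣ n - 1 then ⌈(n : ℚ) / (2 * (a : ℚ))⌉₊ - 1
      else ⌈(n : ℚ) / (2 * (a : ℚ))⌉₊ := by
  obtain ⟨c, r, hr, hc⟩ : ∃ c r, r < 2 * a ∧ n = 2 * (a * c) + r + 1 := by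
    refine ⟨(n - 1) / (2 * a), (n - 1) % (2 * a), Nat.mod_lt _ (by omega), ?_⟩
    have := Nat.div_add_mod (n - 1) (2 * a)
    rw [mul_assoc] at this
    omega
  have hceil : ⌈(n : ℚ) / (2 * (a : ℚ))⌉₊ = c + 1 := by
    have := ceil_div_eq (c := c) (d := 2 * a) (n := n) (by rw [mul_assoc]; omega)
      (by rw [mul_add, mul_assoc]; omega)
    exact_mod_cast this
  have hdvd : 2 * a ∣ n - 1 ↔ r = 0 := by
    rw [show n - 1 = 2 * a * c + r by rw [mul_assoc]; omega, Nat.dvd_add_right (dvd_mul_right _ _)]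
    exact ⟨fun h => Nat.eq_zero_of_dvd_of_lt h hr, fun h => h ▸ dvd_zero _⟩
  rw [hceil]
  split_ifs with h <;> rw [hdvd] at h
  · refine Nat.div_eq_of_lt_le ?_ ?_
    · rw [Nat.add_sub_cancel, mul_comm]
      omega
    · rw [Nat.add_sub_cancel, mul_comm, Nat.mul_add_one]
      omega
  · refine Nat.div_eq_of_lt_le ?_ ?_
    · rw [mul_comm, Nat.mul_add_one]
      omega
    · rw [mul_comm, Nat.mul_add_one, Nat.mul_add_one]
      omega

end PositionalGame

open PositionalGame in
theorem theorem1 (a : ℕ) (ha : 1 ≤ a) :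
    ∃ N : ℕ, ∀ n : ℕ, N ≤ n →
      PositionalGame.shortestDuration (PositionalGame.completeEdges n)
          (PositionalGame.perfectMatchings n) a a =
        ((if a = 1 ∧ Even n then n / (2 * a) + 1
          else if 2 * a ∣ n - 1 then ⌈(n : ℚ) / (2 * (a : ℚ))⌉₊ - 1
          else ⌈(n : ℚ) / (2 * (a : ℚ))⌉₊ : ℕ) : ℕ∞) := by
  -- Large enough for two clearing rounds before the endgame: `8 ≤ n` if `a = 1` and `n` is even, `4
  -- * a + 2 ≤ n` if `a ≥ 2`.
  refine ⟨4 * a + 8, fun n hn => ?_⟩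
  rw [← ceil_half_div_eq ha (by omega)]
  split_ifs with h
  · obtain ⟨rfl, heven⟩ := h
    rw [mul_one]
    refine shortestDuration_eq (canWin_one_even heven (by omega)).makerWinsWithin fun s hs => ?_
    have h1 := half_le_of_makerWinsWithin hs
    have h2 : s ≠ n / 2 := by
      rintro rfl
      exact not_makerWinsWithin_half heven (by omega) hs
    omega
  · refine shortestDuration_eq ?_ fun s hs => ?_
    · rcases (show a = 1 ∨ 2 ≤ a by omega) with rfl | ha2
      · rw [Nat.add_sub_cancel, Nat.div_one]
        exact (canWin_one_odd (Nat.not_even_iff_odd.1 fun he => h ⟨rfl, he⟩)).makerWinsWithin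
      · exact (canWin_two_le ha2 (by omega)).makerWinsWithin
    · have h1 := half_le_of_makerWinsWithin hs
      rw [← Nat.lt_add_one_iff, Nat.div_lt_iff_lt_mul (by omega), mul_comm, Nat.mul_add_one]
      omega
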